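/- **Corollary 2.3** (Yan–Zhang). Let $G$ be a finite simple plane graph (a graph drawn in the plane without crossings) which is bipartite with colour classes $U$ and $V$, $|U|=|V|=n$, and whose edges carry weights in a commutative semiring (for instance real numbers, or indeterminates; all weights equal to $1$ gives plain counting). For a set $S$ of vertices let $G-S$ be the graph obtained by deleting the vertices of $S$ and their incident edges, and let $M(H)$ denote the sum, over all perfect matchings of a weighted graph $H$, of the product of the weights of the edges of the matching (so $M(H)=1$ if $H$ has no vertices). Let the vertices $a_1,b_1,a_2,b_2,\dots,a_k,b_k$ appear in this cyclic order on a face $F$ of $G$: that is, there is a closed topological disc which is contained in $F$ except that its boundary circle passes through these $2k$ distinct vertices, in this cyclic order. Suppose that $A=\{a_1,\dots,a_k\}\subseteq U$ and $B=\{b_1,\dots,b_k\}\subseteq V$. Then for every $j\in\{1,\dots,k\}$, $$M(G)\,M(G-(A\cup B))=\sum_{i=1}^{k} M(G-\{a_j,b_i\})\;M\bigl(G-((A\cup B)\setminus\{a_j,b_i\})\bigr).$$ -/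

import Mathlib

/-- A plane graph: a drawing of the simple graph `G` in the Euclidean plane (the complex plane).
Vertices are distinct points, every edge is a simple arc joining the points of its two ends, the
interior of an edge contains no vertex, and two distinct edges meet at most in vertices. -/
structure PlaneDrawing {W : Type*} (G : SimpleGraph W) where
  /-- the point representing a vertex -/
  pos : W → ℂ
  pos_injective : Function.Injective pos
  /-- a parametrization of the arc representing an edge -/
  curve : G.edgeSet → C(unitInterval, ℂ)
  curve_injective : ∀ e, Function.Injective (curve e)
  curve_ends : ∀ e, s(curve e 0, curve e 1) = Sym2.map pos (e : Sym2 W)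
  curve_interior : ∀ e t, t ∈ Set.Ioo (0 : unitInterval) 1 → curve e t ∉ Set.range pos
  curve_inter : ∀ e e' s t, e ≠ e' → curve e s = curve e' t → curve e s ∈ Set.range pos

namespace PlaneDrawing

variable {W : Type*} {G : SimpleGraph W}

/-- The set of all points of the plane that lie on a vertex or an edge. -/
def carrier (D : PlaneDrawing G) : Set ℂ :=
  Set.range D.pos ∪ ⋃ e, Set.range (D.curve e)

/-- A face is a connected component of the complement of the drawing. -/
def IsFace (D : PlaneDrawing G) (F : Set ℂ) : Prop :=
  ∃ z ∈ D.carrierᶜ, F = connectedComponentIn D.carrierᶜ z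

/-- The vertices `c 0, c 1, …, c (m - 1)` appear in this cyclic order on `F`: there is a closed
topological disc (an embedded copy, under `h`, of the closed unit disc) which is contained in `F`
except that its boundary circle passes through these vertices, in this cyclic order. The disc lies
in the face, so the whole graph is on the other side of its boundary circle. When the boundary of
the face is a single closed walk, this says that the walk meets the vertices in this cyclic order,
in one of its two directions; it makes sense also when the boundary is disconnected.
In particular the vertices are distinct. -/
def InCyclicOrderOn (D : PlaneDrawing G) (F : Set ℂ) {m : ℕ} (c : Fin m → W) : Prop :=
  ∃ (h : ℂ → ℂ) (θ : Fin m → ℝ),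
    ContinuousOn h (Metric.closedBall 0 1) ∧
    Set.InjOn h (Metric.closedBall 0 1) ∧
    StrictMono θ ∧
    (∀ i, θ i ∈ Set.Ico 0 (2 * Real.pi)) ∧
    (∀ i, h (Complex.exp (θ i * Complex.I)) = D.pos (c i)) ∧
    ∀ z ∈ Metric.closedBall (0 : ℂ) 1,
      (∀ i, z ≠ Complex.exp (θ i * Complex.I)) → h z ∈ F

end PlaneDrawing

/-- The sequence `a 0, b 0, a 1, b 1, …, a (k - 1), b (k - 1)`. -/
def interleave {W : Type*} {k : ℕ} (a b : Fin k → W) : Fin (2 * k) → W := fun i =>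
  if (i : ℕ) % 2 = 0 then a ⟨(i : ℕ) / 2, by omega⟩ else b ⟨(i : ℕ) / 2, by omega⟩

/-- `M(G)`: the sum, over the perfect matchings of the finite graph `G`, of the product of the
weights of the edges of the matching. Only the values of `w` on edges of `G` matter. -/
noncomputable def matchingSum {R : Type*} [CommSemiring R] {W : Type*} [Finite W]
    (G : SimpleGraph W) (w : Sym2 W → R) : R :=
  ∑ᶠ P : {P : G.Subgraph // P.IsPerfectMatching}, ∏ᶠ e : P.1.edgeSet, w e

/-- `M(G - S)`: the sum of weights of perfect matchings of the graph obtained from `G` by deleting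
the vertices in `S` and their incident edges; the other edges keep their weights. -/
noncomputable def matchingSumDelete {R : Type*} [CommSemiring R] {W : Type*} [Finite W]
    (G : SimpleGraph W) (w : Sym2 W → R) (S : Set W) : R :=
  matchingSum (G.induce Sᶜ) (fun e => w (Sym2.map Subtype.val e))

open Set Complex Metric
open scoped symmDiff

/-! Superpose a perfect matching of `G - S` and one of `G - (C \ S)`, where `S ⊆ C` and `C` is the
set of the vertices `c 0, …, c (m - 1)` on the face. The vertices of `C` are the ends of the paths
in the superposition, and disjoint paths cannot cross outside the face, so each path joins some
`c i` to some `c i'` with `i + i'` odd. Exchanging the two matchings along the path from `c i` to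
`c i'` replaces `S` by `S ∆ {c i, c i'}` and keeps the product of the weights. Hence
`M(G - S ∆ {c i}) M(G - (C \ S ∆ {c i}))` has the same sum over the even as over the odd `i`; take
`S = {a j}`, and note that deleting two vertices of the same colour leaves no perfect matching.

Planarity enters through continuous logarithms: if two compact sets, each together with the same
connected set, do not separate `p` from `q`, then the logarithms of `(z - p) / (z - q)` on them glue
to one on their union. On the boundary curve of an embedded disc that contains `p` but not `q`
there is none. -/

/-- The function `f` has a continuous logarithm on `s`. For `f z = (z - p) / (z - q)` on a compact
plane set `s` this says that `s` does not separate `p` from `q`, and for `f z = z - p` that `s` does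
not wind around `p`. -/
def HasLogOn {X : Type*} [TopologicalSpace X] (f : X → ℂ) (s : Set X) : Prop :=
  ∃ l : X → ℂ, ContinuousOn l s ∧ ∀ x ∈ s, exp (l x) = f x

theorem exists_eq_add_of_exp_eq_mul_exp {X : Type*} [TopologicalSpace X] {s : Set X}
    (hs : IsPreconnected s) {f g : X → ℂ} (hf : ContinuousOn f s) (hg : ContinuousOn g s) {c : ℂ}
    (hc : c ≠ 0) (h : ∀ x ∈ s, exp (f x) = c * exp (g x)) :
    ∃ d, exp d = c ∧ ∀ x ∈ s, f x = g x + d := by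
  rcases s.eq_empty_or_nonempty with rfl | ⟨y, hy⟩
  · exact ⟨log c, exp_log hc, by simp⟩
  have hd : exp (f y - g y) = c := by
    rw [exp_sub, h y hy, mul_div_cancel_right₀ _ (exp_ne_zero _)]
  refine ⟨f y - g y, hd, isCoveringMap_exp.eqOn_of_comp_eqOn hs hf (hg.add continuousOn_const)
    (fun x hx => Subtype.ext ?_) hy (by ring)⟩
  change exp (f x) = exp (g x + (f y - g y))
  rw [exp_add, hd, h x hx, mul_comm]

namespace HasLogOn

variable {X Y : Type*} [TopologicalSpace X] [TopologicalSpace Y] {f g : X → ℂ} {s t : Set X}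

theorem mono (h : HasLogOn f t) (hst : s ⊆ t) : HasLogOn f s :=
  let ⟨l, hl, hf⟩ := h
  ⟨l, hl.mono hst, fun x hx => hf x (hst hx)⟩

theorem congr (h : HasLogOn f s) (hfg : EqOn f g s) : HasLogOn g s :=
  let ⟨l, hl, hf⟩ := h
  ⟨l, hl, fun x hx => (hf x hx).trans (hfg hx)⟩

theorem const {c : ℂ} (hc : c ≠ 0) : HasLogOn (fun _ : X => c) s :=
  ⟨fun _ => log c, continuousOn_const, fun _ _ => exp_log hc⟩

theorem mul (hf : HasLogOn f s) (hg : HasLogOn g s) : HasLogOn (fun x => f x * g x) s :=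
  let ⟨k, hk, hkf⟩ := hf
  let ⟨l, hl, hlg⟩ := hg
  ⟨fun x => k x + l x, hk.add hl, fun x hx => by rw [exp_add, hkf x hx, hlg x hx]⟩

theorem comp (hf : HasLogOn f s) {u : Y → X} {r : Set Y} (hu : ContinuousOn u r)
    (hm : MapsTo u r s) : HasLogOn (f ∘ u) r :=
  let ⟨l, hl, hlf⟩ := hf
  ⟨l ∘ u, hl.comp hu hm, fun _ hy => hlf _ (hm hy)⟩

theorem of_homotopy (H : ℝ → X → ℂ)
    (hH : ContinuousOn (fun p : ℝ × X => H p.1 p.2) (Icc 0 1 ×ˢ s))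
    (hne : ∀ t ∈ Icc (0 : ℝ) 1, ∀ x ∈ s, H t x ≠ 0) (h₀ : HasLogOn (H 0) s) :
    HasLogOn (H 1) s := by
  classical
  obtain ⟨l, hl, hlH⟩ := h₀
  let F : C(unitInterval × s, {z : ℂ // z ≠ 0}) :=
    ⟨fun p => ⟨H p.1 p.2, hne _ p.1.2 _ p.2.2⟩, (hH.comp_continuous
      (f := fun p : unitInterval × s => ((p.1 : ℝ), (p.2 : X)))
      (by fun_prop) fun p => ⟨p.1.2, p.2.2⟩).subtype_mk _⟩
  let l' : C(s, ℂ) := ⟨fun x => l x, continuousOn_iff_continuous_domRestrict.mp hl⟩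
  have hF : ∀ x, F (0, x) = ⟨exp (l' x), exp_ne_zero _⟩ := fun x =>
    Subtype.ext (hlH x x.2).symm
  have hlift := isCoveringMap_exp.liftHomotopy_lifts F l' hF
  refine ⟨fun x => if hx : x ∈ s then isCoveringMap_exp.liftHomotopy F l' hF (1, ⟨x, hx⟩) else 0,
    ?_, fun x hx => ?_⟩
  · rw [continuousOn_iff_continuous_domRestrict]
    have : Continuous fun x : s => isCoveringMap_exp.liftHomotopy F l' hF (1, x) := by fun_prop
    convert this using 2 with x
    simp [Set.domRestrict]
  · simpa [hx, F] using congrArg Subtype.val (congrFun hlift (1, ⟨x, hx⟩))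

theorem of_convex {E : Type*} [NormedAddCommGroup E] [NormedSpace ℝ E] {f : E → ℂ} {s : Set E}
    (hs : Convex ℝ s) (hf : ContinuousOn f s) (hne : ∀ x ∈ s, f x ≠ 0) : HasLogOn f s := by
  rcases s.eq_empty_or_nonempty with rfl | ⟨c, hc⟩
  · exact ⟨0, continuousOn_empty _, by simp⟩
  have hmem : ∀ t ∈ Icc (0 : ℝ) 1, ∀ x ∈ s, (1 - t) • c + t • x ∈ s := fun t ht x hx =>
    hs hc hx (by linarith [ht.2]) ht.1 (by ring)
  refine (of_homotopy (fun t x => f ((1 - t) • c + t • x)) ?_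
    (fun t ht x hx => hne _ (hmem t ht x hx)) ?_).congr fun x _ => by simp
  · exact hf.comp (f := fun p : ℝ × E => (1 - p.1) • c + p.1 • p.2)
      (by fun_prop) (fun p hp => hmem _ hp.1 _ hp.2)
  · exact (const (hne c hc)).congr fun x _ => by simp

theorem of_joinedIn {s : Set ℂ} {p q : ℂ} (h : JoinedIn sᶜ p q) :
    HasLogOn (fun z => (z - p) / (z - q)) s := by
  obtain ⟨γ, hγ⟩ := h.symm
  have hmem : ∀ t, ∀ z ∈ s, z - γ.extend t ≠ 0 := fun t z hz h0 => by
    obtain ⟨u, hu⟩ : γ.extend t ∈ range γ := γ.extend_range ▸ mem_range_self t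
    exact hγ u (by rwa [hu, ← sub_eq_zero.mp h0])
  have hq : ∀ z ∈ s, z - q ≠ 0 := fun z hz => by simpa using hmem 0 z hz
  refine (of_homotopy (fun t z => (z - γ.extend t) / (z - q)) ?_
    (fun t _ z hz => div_ne_zero (hmem t z hz) (hq z hz)) ?_).congr fun z _ => by simp
  · exact ContinuousOn.div (by fun_prop) (by fun_prop) fun p hp => hq _ hp.2
  · exact (const one_ne_zero).congr fun z hz => by simp [hq z hz]

theorem union_of_isPreconnected {K A B : Set X} (hK : IsPreconnected K) (hA : IsClosed A)
    (hB : IsClosed B) (hAB : A ∩ B ⊆ K) (hfA : HasLogOn f (K ∪ A)) (hfB : HasLogOn f (K ∪ B)) :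
    HasLogOn f (A ∪ B) := by
  classical
  obtain ⟨k, hk, hkf⟩ := hfA
  obtain ⟨l, hl, hlf⟩ := hfB
  obtain ⟨d, hd, hkl⟩ := exists_eq_add_of_exp_eq_mul_exp hK (hk.mono subset_union_left)
    (hl.mono subset_union_left) one_ne_zero fun x hx => by
      rw [hkf x (Or.inl hx), hlf x (Or.inl hx), one_mul]
  let g : X → ℂ := A.piecewise k fun x => l x + d
  have hgA : EqOn g k A := piecewise_eqOn ..
  have hgB : EqOn g (fun x => l x + d) B := fun x hx => by
    by_cases hxA : x ∈ A
    · exact (hgA hxA).trans (hkl x (hAB ⟨hxA, hx⟩))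
    · exact piecewise_eqOn_compl A _ _ hxA
  refine ⟨g, .union_of_isClosed ((hk.mono subset_union_right).congr hgA)
    (((hl.mono subset_union_right).add continuousOn_const).congr hgB) hA hB, ?_⟩
  rintro x (hx | hx)
  · rw [hgA hx, hkf x (Or.inr hx)]
  · rw [hgB hx, exp_add, hd, mul_one, hlf x (Or.inr hx)]

end HasLogOn

theorem not_hasLogOn_sphere_of_odd {f : ℂ → ℂ} (hf : ∀ z ∈ sphere (0 : ℂ) 1, f (-z) = -f z) :
    ¬ HasLogOn f (sphere 0 1) := by
  rintro ⟨l, hl, hlf⟩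
  have hneg : MapsTo (fun z : ℂ => -z) (sphere 0 1) (sphere 0 1) := fun z hz => by simpa using hz
  have hconn : IsPreconnected (sphere (0 : ℂ) 1) :=
    isPreconnected_sphere (by simp [rank_real_complex]) 0 1
  obtain ⟨d, hd, hld⟩ := exists_eq_add_of_exp_eq_mul_exp hconn (hl.comp continuousOn_neg hneg) hl
    (neg_ne_zero.mpr one_ne_zero) fun z hz => by
      rw [Function.comp_apply, hlf _ (hneg hz), hf z hz, hlf z hz, neg_one_mul]
  have hd₁ : l (-1) = l 1 + d := hld 1 (by simp)
  have hd₂ : l 1 = l (-1) + d := by simpa using hld (-1) (by simp)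
  have hd₀ : d = 0 := by linear_combination (hd₁ + hd₂) / (-2)
  rw [hd₀, exp_zero] at hd
  norm_num at hd

theorem not_hasLogOn_sphere_of_injOn {h : ℂ → ℂ} (hc : ContinuousOn h (closedBall 0 1))
    (hi : InjOn h (closedBall 0 1)) : ¬ HasLogOn (fun z => h z - h 0) (sphere 0 1) := by
  intro hlog
  have hmem : ∀ t ∈ Icc (0 : ℝ) 1, ∀ z ∈ sphere (0 : ℂ) 1, -(t * z) ∈ closedBall (0 : ℂ) 1 :=
    fun t ht z hz => by
      simpa [mem_sphere_zero_iff_norm.mp hz, abs_of_nonneg ht.1] using ht.2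
  -- `z ↦ h z - h 0` is homotopic to the odd function `z ↦ h z - h (-z)`.
  refine not_hasLogOn_sphere_of_odd (f := fun z => h z - h (-z)) (fun z _ => by simp)
    ((HasLogOn.of_homotopy (fun (t : ℝ) z => h z - h (-(t * z))) ?_ ?_ ?_).congr fun z _ => by simp)
  · exact (hc.comp continuousOn_snd fun p hp => sphere_subset_closedBall hp.2).sub
      (hc.comp (f := fun p : ℝ × ℂ => -((p.1 : ℂ) * p.2)) (by fun_prop)
        fun p hp => hmem _ hp.1 _ hp.2)
  · intro t ht z hz h0
    have hz0 : z ≠ 0 := ne_of_mem_sphere hz one_ne_zero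
    have heq : z = -(t * z) :=
      hi (sphere_subset_closedBall hz) (hmem t ht z hz) (sub_eq_zero.mp h0)
    have h1 : (1 + t : ℂ) ≠ 0 := by exact_mod_cast (by linarith [ht.1] : 1 + t ≠ 0)
    exact mul_ne_zero h1 hz0 (by linear_combination heq)
  · exact hlog.congr fun z _ => by simp

theorem exists_not_hasLogOn_frontier {h : ℂ → ℂ} {C : Set ℂ} (hC : Convex ℝ C)
    (hcl : IsClosed C) (hne : (interior C).Nonempty) (hb : Bornology.IsBounded C)
    (hc : ContinuousOn h C) (hi : InjOn h C) :
    ∃ c ∈ interior C, ¬ HasLogOn (fun z => h z - h c) (frontier C) := by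
  obtain ⟨e, he_int, he_cl, he_fr⟩ :=
    exists_homeomorph_image_interior_closure_frontier_eq_unitBall hC hne hb
  rw [hcl.closure_eq] at he_cl
  have hmem : ∀ {s t : Set ℂ}, e '' s = t → MapsTo e.symm t s := by
    rintro s _ rfl _ ⟨x, hx, rfl⟩
    rwa [e.symm_apply_apply]
  refine ⟨e.symm 0, hmem he_int (mem_ball_self one_pos), fun hlog => ?_⟩
  exact not_hasLogOn_sphere_of_injOn (h := h ∘ e.symm)
    (hc.comp e.symm.continuous.continuousOn (hmem he_cl))
    (hi.comp e.symm.injective.injOn (hmem he_cl))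
    (hlog.comp e.symm.continuous.continuousOn (hmem he_fr))

theorem frontier_closedBall_inter_le_subset {X : Type*} [PseudoMetricSpace X] (x : X) (ε r : ℝ)
    {L : X → ℝ} (hL : Continuous L) :
    frontier (closedBall x ε ∩ {z | r ≤ L z}) ⊆
      closedBall x ε ∩ {z | L z = r} ∪ sphere x ε ∩ {z | r ≤ L z} := by
  refine (frontier_inter_subset _ _).trans (union_comm _ _ ▸ union_subset_union ?_ ?_)
  · rw [isClosed_closedBall.closure_eq]
    exact inter_subset_inter_right _ ((frontier_le_subset_eq continuous_const hL).trans
      fun z hz => Eq.symm hz)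
  · rw [(isClosed_le continuous_const hL).closure_eq]
    exact inter_subset_inter_left _ frontier_closedBall_subset_sphere

theorem interior_setOf_le_continuousLinearMap {E : Type*} [NormedAddCommGroup E] [NormedSpace ℝ E]
    {L : E →L[ℝ] ℝ} (hL : L ≠ 0) (r : ℝ) : interior {z | r ≤ L z} = {z | r < L z} := by
  have := (L.isOpenMap_of_ne_zero hL).preimage_interior_eq_interior_preimage L.continuous (Ici r)
  rw [interior_Ici] at this
  exact this.symm

theorem segment_subset_insert_interior {E : Type*} [NormedAddCommGroup E] [NormedSpace ℝ E]
    {s : Set E} (hs : Convex ℝ s) {x y : E} (hx : x ∈ interior s) (hy : y ∈ s) :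
    segment ℝ x y ⊆ insert y (interior s) := by
  rw [← insert_endpoints_openSegment]
  exact insert_subset (Or.inr hx) (insert_subset_insert
    (hs.openSegment_interior_self_subset_interior hx hy))

theorem joinedIn_compl_union_image {E Y : Type*} [NormedAddCommGroup E] [NormedSpace ℝ E]
    [TopologicalSpace Y] {h : E → Y} {s A : Set E} {K : Set Y} {x y : E} (hc : ContinuousOn h s)
    (hi : InjOn h s) (hA : A ⊆ s) (hs : segment ℝ x y ⊆ s) (hAxy : Disjoint A (segment ℝ x y))
    (hK : Disjoint K (h '' segment ℝ x y)) : JoinedIn (K ∪ h '' A)ᶜ (h x) (h y) := by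
  have hsub : h '' segment ℝ x y ⊆ (K ∪ h '' A)ᶜ := by
    rw [subset_compl_iff_disjoint_left, disjoint_union_left]
    exact ⟨hK, disjoint_image_image fun a ha b hb hab =>
      disjoint_left.mp hAxy ha (hi (hA ha) (hs hb) hab ▸ hb)⟩
  exact ((JoinedIn.of_segment_subset subset_rfl).map_continuousOn (hc.mono hs)).mono hsub

theorem exists_not_joinedIn_of_frontier_subset_union {h : ℂ → ℂ} {s C A B K : Set ℂ} {q : ℂ}
    (hc : ContinuousOn h s) (hi : InjOn h s) (hC : Convex ℝ C) (hCc : IsCompact C)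
    (hne : (interior C).Nonempty) (hCs : C ⊆ s) (hA : IsCompact A) (hAs : A ⊆ s)
    (hB : IsCompact B) (hBs : B ⊆ s) (hfr : frontier C ⊆ A ∪ B) (hK : IsPreconnected K)
    (hAB : h '' (A ∩ B) ⊆ K) (hq : q ∈ s \ C) :
    ∃ p ∈ interior C,
      JoinedIn (K ∪ h '' A)ᶜ (h p) (h q) → ¬ JoinedIn (K ∪ h '' B)ᶜ (h p) (h q) := by
  obtain ⟨p, hpC, hp⟩ := exists_not_hasLogOn_frontier hC hCc.isClosed hne hCc.isBounded
    (hc.mono hCs) (hi.mono hCs)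
  refine ⟨p, hpC, fun hpA hpB => hp ?_⟩
  have hglue : HasLogOn (fun z => (z - h p) / (z - h q)) (h '' A ∪ h '' B) :=
    .union_of_isPreconnected hK (hA.image_of_continuousOn (hc.mono hAs)).isClosed
      (hB.image_of_continuousOn (hc.mono hBs)).isClosed (hi.image_inter hAs hBs ▸ hAB)
      (.of_joinedIn hpA) (.of_joinedIn hpB)
  have hlog_div : HasLogOn (fun z => (h z - h p) / (h z - h q)) (frontier C) :=
    hglue.comp (hc.mono (hCc.isClosed.frontier_subset.trans hCs))
      fun z hz => image_union h A B ▸ mem_image_of_mem h (hfr hz)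
  have hzq : ∀ z ∈ C, h z - h q ≠ 0 := fun z hz h0 =>
    hq.2 (hi (hCs hz) hq.1 (sub_eq_zero.mp h0) ▸ hz)
  have hlog_q : HasLogOn (fun z => h z - h q) C :=
    .of_convex hC ((hc.mono hCs).sub continuousOn_const) hzq
  exact (hlog_div.mul (hlog_q.mono hCc.isClosed.frontier_subset)).congr fun z hz =>
    div_mul_cancel₀ _ (hzq z (hCc.isClosed.frontier_subset hz))

theorem exists_not_joinedIn_compl_union_chord {h : ℂ → ℂ} (hc : ContinuousOn h (closedBall 0 1))
    (hi : InjOn h (closedBall 0 1)) {K : Set ℂ} (hK : IsPreconnected K)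
    (hKd : Disjoint K (h '' ball 0 1)) {L : ℂ →L[ℝ] ℝ} (hL : L ≠ 0) {r : ℝ}
    (hLK : ∀ z ∈ sphere (0 : ℂ) 1, L z = r → h z ∈ K)
    (hne : ({z | r < L z} ∩ ball 0 1).Nonempty) {q : ℂ} (hq : q ∈ ball (0 : ℂ) 1) (hqL : L q < r) :
    ∃ p ∈ ball (0 : ℂ) 1, r < L p ∧
      ¬ JoinedIn (K ∪ h '' (closedBall 0 1 ∩ {z | L z = r}))ᶜ (h p) (h q) := by
  have hball := ball_subset_closedBall (x := (0 : ℂ)) (ε := 1)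
  have hsph := sphere_subset_closedBall (x := (0 : ℂ)) (ε := 1)
  have hint : interior (closedBall (0 : ℂ) 1 ∩ {z | r ≤ L z}) = {z | r < L z} ∩ ball 0 1 := by
    rw [interior_inter, interior_closedBall _ one_ne_zero,
      interior_setOf_le_continuousLinearMap hL, inter_comm]
  have hclosed : IsClosed {z | r ≤ L z} := isClosed_le continuous_const L.continuous
  obtain ⟨p, hp, hpq⟩ := exists_not_joinedIn_of_frontier_subset_union hc hi
    ((convex_closedBall _ _).inter (convex_halfSpace_ge L.toLinearMap.isLinear r))
    ((isCompact_closedBall _ _).inter_right hclosed) (hint ▸ hne) inter_subset_left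
    ((isCompact_closedBall _ _).inter_right (isClosed_eq L.continuous continuous_const))
    inter_subset_left ((isCompact_sphere _ _).inter_right hclosed)
    (inter_subset_left.trans hsph) (frontier_closedBall_inter_le_subset 0 1 r L.continuous) hK
    (by rintro _ ⟨z, ⟨hz₁, hz₂⟩, rfl⟩; exact hLK z hz₂.1 hz₁.2)
    ⟨hball hq, fun hqC => hqL.not_ge hqC.2⟩
  obtain ⟨hpL, hpb⟩ : r < L p ∧ p ∈ ball (0 : ℂ) 1 := hint.subset hp
  refine ⟨p, hpb, hpL, fun hj => hpq hj ?_⟩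
  have hseg := (convex_ball (0 : ℂ) 1).segment_subset hpb hq
  exact joinedIn_compl_union_image hc hi (inter_subset_left.trans hsph) (hseg.trans hball)
    ((sphere_disjoint_ball.mono_left inter_subset_left).mono_right hseg)
    (hKd.mono_right (image_mono hseg))

theorem not_joinedIn_of_separated_in_disc {h : ℂ → ℂ} (hc : ContinuousOn h (closedBall 0 1))
    (hi : InjOn h (closedBall 0 1)) {K₁ K₂ : Set ℂ} (hK : Disjoint K₁ K₂)
    (hK₁ : IsPreconnected K₁) (hd₁ : Disjoint K₁ (h '' ball 0 1))
    (hd₂ : Disjoint K₂ (h '' ball 0 1)) {L : ℂ →L[ℝ] ℝ} {r : ℝ}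
    (hLK : ∀ z ∈ sphere (0 : ℂ) 1, L z = r → h z ∈ K₁) {a b : ℂ} (ha : a ∈ sphere (0 : ℂ) 1)
    (hb : b ∈ sphere (0 : ℂ) 1) (hLa : r < L a) (hLb : L b < r) :
    ¬ JoinedIn K₂ (h a) (h b) := by
  intro hab
  have hL : L ≠ 0 := by
    rintro rfl
    exact lt_asymm hLa hLb
  have hnear : ∀ x ∈ sphere (0 : ℂ) 1, ∀ O : Set ℂ, IsOpen O → x ∈ O →
      (O ∩ ball (0 : ℂ) 1).Nonempty := fun x hx O hO hxO =>
    mem_closure_iff.mp (closure_ball (0 : ℂ) one_ne_zero ▸ sphere_subset_closedBall hx) O hO hxO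
  obtain ⟨q, hqL, hqb⟩ := hnear b hb _ (isOpen_lt L.continuous continuous_const) hLb
  obtain ⟨p, hpb, hpL, hpq⟩ := exists_not_joinedIn_compl_union_chord hc hi hK₁ hd₁ hL hLK
    (hnear a ha _ (isOpen_lt continuous_const L.continuous) hLa) hqb hqL
  have hK₂ : K₂ ⊆ (K₁ ∪ h '' (closedBall 0 1 ∩ {z | L z = r}))ᶜ := by
    rintro _ hzK (hzK₁ | ⟨z, hz, rfl⟩)
    · exact disjoint_left.mp hK hzK₁ hzK
    rcases (mem_closedBall_zero_iff.mp hz.1).lt_or_eq with hlt | heq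
    · exact disjoint_left.mp hd₂ hzK (mem_image_of_mem h (mem_ball_zero_iff.mpr hlt))
    · exact disjoint_left.mp hK (hLK z (mem_sphere_zero_iff_norm.mpr heq) hz.2) hzK
  have hside : ∀ x ∈ ball (0 : ℂ) 1, ∀ y ∈ sphere (0 : ℂ) 1, h y ∈ K₂ →
      (∀ z ∈ segment ℝ x y, L z ≠ r) →
      JoinedIn (K₁ ∪ h '' (closedBall 0 1 ∩ {z | L z = r}))ᶜ (h x) (h y) := by
    intro x hx y hy hyK hxy
    rw [← interior_closedBall (0 : ℂ) one_ne_zero] at hx hd₁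
    have hseg := segment_subset_insert_interior (convex_closedBall _ _) hx
      (sphere_subset_closedBall hy)
    refine joinedIn_compl_union_image hc hi inter_subset_left
      (hseg.trans (insert_subset (sphere_subset_closedBall hy) interior_subset))
      (disjoint_left.mpr fun z hz hz' => hxy z hz' hz.2) (Disjoint.mono_right (image_mono hseg) ?_)
    rw [image_insert_eq, disjoint_insert_right]
    exact ⟨disjoint_right.mp hK hyK, hd₁⟩
  refine hpq ((hside p hpb a ha hab.source_mem fun z hz => ?_).trans ((hab.mono hK₂).trans
    (hside q hqb b hb hab.target_mem fun z hz => ?_).symm))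
  · exact ((convex_halfSpace_gt L.toLinearMap.isLinear r).segment_subset hpL hLa hz).ne'
  · exact ((convex_halfSpace_lt L.toLinearMap.isLinear r).segment_subset hqL hLb hz).ne

theorem cos_sub_cos_half_sub (α γ t : ℝ) :
    Real.cos (t - (α + γ) / 2) - Real.cos ((γ - α) / 2) =
      2 * (Real.sin ((t - α) / 2) * Real.sin ((γ - t) / 2)) := by
  rw [Real.cos_sub_cos, show (t - (α + γ) / 2 + (γ - α) / 2) / 2 = (t - α) / 2 by ring,
    show (t - (α + γ) / 2 - (γ - α) / 2) / 2 = -((γ - t) / 2) by ring, Real.sin_neg]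
  ring

theorem exp_mul_I_eq_or_of_cos_eq {α γ t : ℝ}
    (h : Real.cos (t - (α + γ) / 2) = Real.cos ((γ - α) / 2)) :
    exp (t * I) = exp (α * I) ∨ exp (t * I) = exp (γ * I) := by
  obtain ⟨k, hk | hk⟩ := Real.cos_eq_cos_iff.mp h.symm
  · refine Or.inr (exp_eq_exp_iff_exists_int.mpr ⟨k, ?_⟩)
    rw [show t = γ + 2 * k * Real.pi by linear_combination hk]
    push_cast
    ring
  · refine Or.inl (exp_eq_exp_iff_exists_int.mpr ⟨k, ?_⟩)
    rw [show t = α + 2 * k * Real.pi by linear_combination hk]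
    push_cast
    ring

theorem not_joinedIn_of_cyclic_order {h : ℂ → ℂ} (hc : ContinuousOn h (closedBall 0 1))
    (hi : InjOn h (closedBall 0 1)) {K₁ K₂ : Set ℂ} (hK : Disjoint K₁ K₂)
    (hK₁ : IsPreconnected K₁) (hd₁ : Disjoint K₁ (h '' ball 0 1))
    (hd₂ : Disjoint K₂ (h '' ball 0 1)) {α β γ δ : ℝ} (hαβ : α < β) (hβγ : β < γ) (hγδ : γ < δ)
    (hδα : δ < α + 2 * Real.pi) (hα : h (exp (α * I)) ∈ K₁) (hγ : h (exp (γ * I)) ∈ K₁) :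
    ¬ JoinedIn K₂ (h (exp (β * I))) (h (exp (δ * I))) := by
  have hmem : ∀ t : ℝ, exp (t * I) ∈ sphere (0 : ℂ) 1 := fun t => by
    simp [norm_exp_ofReal_mul_I]
  -- the chord from `exp (α * I)` to `exp (γ * I)` lies on the line `L z = cos ((γ - α) / 2)`
  let L : ℂ →L[ℝ] ℝ := reCLM ∘L ContinuousLinearMap.mul ℝ ℂ (exp (-((α + γ) / 2 : ℝ) * I))
  have hL : ∀ t : ℝ, L (exp (t * I)) = Real.cos (t - (α + γ) / 2) := fun t => by
    change (exp _ * exp _).re = _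
    rw [← exp_add, ← exp_ofReal_mul_I_re]
    push_cast
    ring_nf
  have hpos : ∀ x : ℝ, 0 < x → x < 2 * Real.pi → 0 < Real.sin (x / 2) := fun x h0 h1 =>
    Real.sin_pos_of_pos_of_lt_pi (by linarith) (by linarith)
  refine not_joinedIn_of_separated_in_disc hc hi hK hK₁ hd₁ hd₂ (L := L)
    (r := Real.cos ((γ - α) / 2)) (fun z hz hLz => ?_) (hmem β) (hmem δ) ?_ ?_
  · obtain ⟨t, rfl⟩ : ∃ t : ℝ, exp (t * I) = z :=
      ⟨arg z, by simpa [mem_sphere_zero_iff_norm.mp hz] using norm_mul_exp_arg_mul_I z⟩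
    rw [hL] at hLz
    rcases exp_mul_I_eq_or_of_cos_eq hLz with ht | ht <;> rw [ht] <;> assumption
  · rw [hL, ← sub_pos, cos_sub_cos_half_sub]
    have := hpos (β - α) (by linarith) (by linarith)
    have := hpos (γ - β) (by linarith) (by linarith)
    positivity
  · rw [hL, ← sub_neg, cos_sub_cos_half_sub, ← neg_sub δ γ, neg_div, Real.sin_neg]
    have := hpos (δ - α) (by linarith) (by linarith)
    have := hpos (δ - γ) (by linarith) (by linarith)
    have : 0 < Real.sin ((δ - α) / 2) * Real.sin ((δ - γ) / 2) := by positivity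
    linarith

namespace PlaneDrawing

variable {W : Type*} {G : SimpleGraph W}

/-- The drawing of the subgraph induced on `T`, as a set of points of the plane. -/
def part (D : PlaneDrawing G) (T : Set W) : Set ℂ :=
  D.pos '' T ∪ ⋃ (e : G.edgeSet) (_ : ∀ v ∈ (e : Sym2 W), v ∈ T), range (D.curve e)

theorem part_subset_carrier (D : PlaneDrawing G) (T : Set W) : D.part T ⊆ D.carrier :=
  union_subset_union (image_subset_range _ _)
    (iUnion_mono fun _ => iUnion_subset fun _ => subset_rfl)

theorem pos_mem_part (D : PlaneDrawing G) {T : Set W} {v : W} (hv : v ∈ T) :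
    D.pos v ∈ D.part T :=
  Or.inl (mem_image_of_mem _ hv)

theorem pos_mem_range_curve (D : PlaneDrawing G) {e : G.edgeSet} {v : W} (hv : v ∈ (e : Sym2 W)) :
    D.pos v ∈ range (D.curve e) := by
  have h : D.pos v ∈ Sym2.map D.pos (e : Sym2 W) := Sym2.mem_map.mpr ⟨v, hv, rfl⟩
  rw [← D.curve_ends e, Sym2.mem_iff] at h
  rcases h with h | h <;> exact ⟨_, h.symm⟩

theorem mem_of_pos_eq_curve (D : PlaneDrawing G) {e : G.edgeSet} {t : unitInterval} {v : W}
    (h : D.pos v = D.curve e t) : v ∈ (e : Sym2 W) := by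
  have ht : t = 0 ∨ t = 1 := by
    by_contra! hne
    exact D.curve_interior e t ⟨unitInterval.pos_iff_ne_zero.mpr hne.1,
      unitInterval.lt_one_iff_ne_one.mpr hne.2⟩ ⟨v, h⟩
  have hmem : D.curve e t ∈ Sym2.map D.pos (e : Sym2 W) := by
    rw [← D.curve_ends e]
    rcases ht with rfl | rfl <;> simp
  obtain ⟨u, hu, hpos⟩ := Sym2.mem_map.mp hmem
  rwa [D.pos_injective (h.trans hpos.symm)]

theorem pos_mem_part_iff (D : PlaneDrawing G) {T : Set W} {v : W} :
    D.pos v ∈ D.part T ↔ v ∈ T := by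
  refine ⟨?_, D.pos_mem_part⟩
  rintro (⟨u, hu, huv⟩ | hv)
  · rwa [← D.pos_injective huv]
  · obtain ⟨e, he, t, ht⟩ := mem_iUnion₂.mp hv
    exact he v (D.mem_of_pos_eq_curve ht.symm)

theorem disjoint_part (D : PlaneDrawing G) {T T' : Set W} (h : Disjoint T T') :
    Disjoint (D.part T) (D.part T') := by
  refine disjoint_left.mpr fun z hz hz' => ?_
  have hpos : z ∉ range D.pos := by
    rintro ⟨v, rfl⟩
    exact disjoint_left.mp h (D.pos_mem_part_iff.mp hz) (D.pos_mem_part_iff.mp hz')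
  obtain ⟨e, he, t, rfl⟩ :=
    mem_iUnion₂.mp (hz.resolve_left fun h => hpos (image_subset_range _ _ h))
  obtain ⟨e', he', t', ht'⟩ :=
    mem_iUnion₂.mp (hz'.resolve_left fun h => hpos (image_subset_range _ _ h))
  have hee : e = e' := by
    by_contra hne
    exact hpos (D.curve_inter e e' t t' hne ht'.symm)
  subst hee
  exact disjoint_left.mp h (he _ (Sym2.out_fst_mem _)) (he' _ (Sym2.out_fst_mem _))

theorem joinedIn_part_of_mem_edge (D : PlaneDrawing G) {T : Set W} (e : G.edgeSet)
    (he : ∀ v ∈ (e : Sym2 W), v ∈ T) {z z' : ℂ} (hz : z ∈ range (D.curve e))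
    (hz' : z' ∈ range (D.curve e)) : JoinedIn (D.part T) z z' := by
  have : PathConnectedSpace unitInterval := isPathConnected_iff_pathConnectedSpace.mp
    ((convex_Icc (0 : ℝ) 1).isPathConnected ⟨0, by simp⟩)
  have h : IsPathConnected (range (D.curve e)) := isPathConnected_range (D.curve e).continuous
  exact (h.joinedIn z hz z' hz').mono fun x hx => Or.inr (mem_iUnion₂.mpr ⟨e, he, hx⟩)

theorem joinedIn_part (D : PlaneDrawing G) {T : Set W} (hT : (G.induce T).Preconnected)
    {u v : W} (hu : u ∈ T) (hv : v ∈ T) : JoinedIn (D.part T) (D.pos u) (D.pos v) := by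
  obtain ⟨p⟩ := hT ⟨u, hu⟩ ⟨v, hv⟩
  suffices H : ∀ {x y : T}, (G.induce T).Walk x y → JoinedIn (D.part T) (D.pos x) (D.pos y) from H p
  intro x y p
  induction p with
  | nil => exact JoinedIn.refl (D.pos_mem_part (Subtype.coe_prop _))
  | @cons x y _ hxy _ ih =>
    have hadj : G.Adj x y := hxy
    refine JoinedIn.trans ?_ ih
    refine D.joinedIn_part_of_mem_edge ⟨s(x, y), hadj⟩ (fun w hw => ?_)
      (D.pos_mem_range_curve (Sym2.mem_mk_left ..)) (D.pos_mem_range_curve (Sym2.mem_mk_right ..))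
    rcases Sym2.mem_iff.mp hw with rfl | rfl
    exacts [x.2, y.2]

theorem isPreconnected_part (D : PlaneDrawing G) {T : Set W} (hT : (G.induce T).Preconnected) :
    IsPreconnected (D.part T) := by
  have hvertex : ∀ z ∈ D.part T, ∃ v ∈ T, JoinedIn (D.part T) (D.pos v) z := by
    rintro z (⟨v, hv, rfl⟩ | hz)
    · exact ⟨v, hv, .refl (D.pos_mem_part hv)⟩
    · obtain ⟨e, he, hz⟩ := mem_iUnion₂.mp hz
      have hv := Sym2.out_fst_mem (e : Sym2 W)
      exact ⟨_, he _ hv, D.joinedIn_part_of_mem_edge e he (D.pos_mem_range_curve hv) hz⟩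
  refine isPreconnected_of_forall_pair fun z hz z' hz' => ?_
  obtain ⟨v, hv, hvz⟩ := hvertex z hz
  obtain ⟨v', hv', hvz'⟩ := hvertex z' hz'
  obtain ⟨γ, hγ⟩ := hvz.symm.trans ((D.joinedIn_part hT hv hv').trans hvz')
  exact ⟨range γ, range_subset_iff.mpr hγ, ⟨0, γ.source⟩, ⟨1, γ.target⟩,
    isPreconnected_range γ.continuous⟩

theorem IsFace.disjoint_carrier {D : PlaneDrawing G} {F : Set ℂ} (hF : D.IsFace F) :
    Disjoint F D.carrier := by
  obtain ⟨z, -, rfl⟩ := hF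
  exact subset_compl_iff_disjoint_right.mp (connectedComponentIn_subset _ _)

theorem InCyclicOrderOn.injective {D : PlaneDrawing G} {F : Set ℂ} {m : ℕ} {c : Fin m → W}
    (hc : D.InCyclicOrderOn F c) : Function.Injective c := by
  obtain ⟨h, θ, -, hi, hθ, hθm, hh, -⟩ := hc
  have hmem : ∀ i, exp (θ i * I) ∈ closedBall (0 : ℂ) 1 := fun i => by
    simp [norm_exp_ofReal_mul_I]
  intro i i' hii
  have := hi (hmem i) (hmem i') ((hh i).trans ((congrArg D.pos hii).trans (hh i').symm))
  exact hθ.injective (Circle.exp_injOn_Ico (by simp) (hθm i) (hθm i') (Circle.ext (by simpa)))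

theorem InCyclicOrderOn.not_disjoint {D : PlaneDrawing G} {F : Set ℂ} (hF : Disjoint F D.carrier)
    {m : ℕ} {c : Fin m → W} (hc : D.InCyclicOrderOn F c) {i₁ i₂ i₃ i₄ : Fin m} (h₁₂ : i₁ < i₂)
    (h₂₃ : i₂ < i₃) (h₃₄ : i₃ < i₄) {T T' : Set W} (hT : (G.induce T).Preconnected)
    (hT' : (G.induce T').Preconnected) (h₁ : c i₁ ∈ T) (h₃ : c i₃ ∈ T) (h₂ : c i₂ ∈ T')
    (h₄ : c i₄ ∈ T') : ¬ Disjoint T T' := by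
  intro hTT
  obtain ⟨h, θ, hcont, hi, hθ, hθm, hh, hface⟩ := hc
  have hball : ∀ S : Set W, Disjoint (D.part S) (h '' ball 0 1) := fun S => by
    refine disjoint_right.mpr ?_
    rintro _ ⟨z, hz, rfl⟩ hzS
    refine disjoint_left.mp hF (hface z (ball_subset_closedBall hz) ?_)
      (D.part_subset_carrier S hzS)
    rintro i rfl
    simp [norm_exp_ofReal_mul_I] at hz
  refine not_joinedIn_of_cyclic_order hcont hi (D.disjoint_part hTT) (D.isPreconnected_part hT)
    (hball T) (hball T') (hθ h₁₂) (hθ h₂₃) (hθ h₃₄)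
    (by linarith [(hθm i₁).1, (hθm i₄).2]) ?_ ?_ ?_
  · rw [hh]; exact D.pos_mem_part h₁
  · rw [hh]; exact D.pos_mem_part h₃
  · rw [hh, hh]; exact D.joinedIn_part hT' h₂ h₄

end PlaneDrawing

section Involution

variable {W : Type*}

/-- The matching given by an involution: every moved point is joined to its image. -/
def involutionGraph (f : W → W) : SimpleGraph W :=
  SimpleGraph.fromRel fun x y => f x = y

/-- The superposition of the matchings given by two involutions. -/
def superposition (f g : W → W) : SimpleGraph W :=
  involutionGraph f ⊔ involutionGraph g

variable {f g : W → W} {x y : W}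

theorem involutionGraph_adj (hf : Function.Involutive f) :
    (involutionGraph f).Adj x y ↔ x ≠ y ∧ f x = y := by
  rw [involutionGraph, SimpleGraph.fromRel_adj, ← hf.eq_iff.trans eq_comm, or_self]

theorem superposition_adj (hf : Function.Involutive f) (hg : Function.Involutive g) :
    (superposition f g).Adj x y ↔ x ≠ y ∧ (f x = y ∨ g x = y) := by
  rw [superposition, SimpleGraph.sup_adj, involutionGraph_adj hf, involutionGraph_adj hg,
    and_or_left]

theorem two_mul_ncard_edgeSet_involutionGraph [Finite W] (hf : Function.Involutive f) :
    2 * (involutionGraph f).edgeSet.ncard + (Function.fixedPoints f).ncard = Nat.card W := by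
  classical
  have := Fintype.ofFinite W
  have hdeg : ∀ x, (involutionGraph f).degree x = if f x = x then 0 else 1 := fun x => by
    split_ifs with hx
    · rw [SimpleGraph.degree_eq_zero]
      exact fun y hy => ((involutionGraph_adj hf).mp hy).1 (hx.symm.trans
        ((involutionGraph_adj hf).mp hy).2)
    · rw [SimpleGraph.degree_eq_one_iff_existsUnique_adj]
      exact ⟨f x, (involutionGraph_adj hf).mpr ⟨Ne.symm hx, rfl⟩,
        fun y hy => ((involutionGraph_adj hf).mp hy).2.symm⟩
  have hfix : (Function.fixedPoints f).ncard = ∑ x, if f x = x then 1 else 0 := by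
    rw [← Finset.card_filter, ← Set.ncard_coe_finset]
    simp [Function.fixedPoints, Function.IsFixedPt]
  rw [← SimpleGraph.coe_edgeFinset, Set.ncard_coe_finset,
    ← SimpleGraph.sum_degrees_eq_twice_card_edges, hfix, ← Finset.sum_add_distrib,
    Nat.card_eq_fintype_card, Fintype.card_eq_sum_ones]
  refine Finset.sum_congr rfl fun x _ => ?_
  rw [hdeg]
  split_ifs <;> rfl

theorem ncard_fixedPoints_add_eq_zero_or_two [Finite W] (hf : Function.Involutive f)
    (hg : Function.Involutive g) (h : (superposition f g).Connected) :
    (Function.fixedPoints f).ncard + (Function.fixedPoints g).ncard = 0 ∨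
      (Function.fixedPoints f).ncard + (Function.fixedPoints g).ncard = 2 := by
  have hedge : (superposition f g).edgeSet.ncard ≤
      (involutionGraph f).edgeSet.ncard + (involutionGraph g).edgeSet.ncard := by
    rw [superposition, SimpleGraph.edgeSet_sup]
    exact ncard_union_le _ _
  have hcard := h.card_vert_le_card_edgeSet_add_one
  rw [Nat.card_coe_set_eq] at hcard
  have := two_mul_ncard_edgeSet_involutionGraph hf
  have := two_mul_ncard_edgeSet_involutionGraph hg
  lia

/-- The vertices of the component of `x` in the superposition of two matchings; this component is a
path or a cycle. -/
def strand (f g : W → W) (x : W) : Set W :=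
  ((superposition f g).connectedComponentMk x).supp

theorem mem_strand : y ∈ strand f g x ↔ (superposition f g).Reachable y x := by
  rw [strand, SimpleGraph.ConnectedComponent.mem_supp_iff, SimpleGraph.ConnectedComponent.eq]

theorem mem_strand_self : x ∈ strand f g x :=
  mem_strand.mpr (SimpleGraph.Reachable.refl x)

theorem mem_strand_comm : y ∈ strand f g x ↔ x ∈ strand f g y := by
  rw [mem_strand, mem_strand, SimpleGraph.reachable_comm]

theorem strand_eq_of_mem (h : y ∈ strand f g x) : strand f g y = strand f g x :=
  congrArg SimpleGraph.ConnectedComponent.supp h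

theorem disjoint_strand_of_notMem (h : y ∉ strand f g x) :
    Disjoint (strand f g x) (strand f g y) :=
  SimpleGraph.pairwise_disjoint_supp_connectedComponent _ fun hxy => h hxy.symm

theorem apply_mem_strand_left (hf : Function.Involutive f) (hg : Function.Involutive g)
    (hy : y ∈ strand f g x) : f y ∈ strand f g x := by
  by_cases h : f y = y
  · rwa [h]
  · exact mem_strand.mpr (.trans (SimpleGraph.Adj.reachable ((superposition_adj hf hg).mpr
      ⟨h, Or.inl (hf y)⟩)) (mem_strand.mp hy))

theorem superposition_comm (f g : W → W) : superposition f g = superposition g f :=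
  sup_comm _ _

theorem strand_comm (f g : W → W) (x : W) : strand f g x = strand g f x := by
  rw [strand, superposition_comm, strand]

theorem apply_mem_strand_right (hf : Function.Involutive f) (hg : Function.Involutive g)
    (hy : y ∈ strand f g x) : g y ∈ strand f g x := by
  rw [strand_comm] at hy ⊢
  exact apply_mem_strand_left hg hf hy

theorem connected_induce_strand (f g : W → W) (x : W) :
    ((superposition f g).induce (strand f g x)).Connected :=
  ((superposition f g).connectedComponentMk x).connected_toSimpleGraph

theorem involutive_restrict (hf : Function.Involutive f) {T : Set W} (h : MapsTo f T T) :
    Function.Involutive (h.restrict f T T) := fun x => Subtype.ext (hf x)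

theorem superposition_restrict (hf : Function.Involutive f) (hg : Function.Involutive g)
    {T : Set W} (hfT : MapsTo f T T) (hgT : MapsTo g T T) :
    superposition (hfT.restrict f T T) (hgT.restrict g T T) = (superposition f g).induce T := by
  ext x y
  simp [superposition_adj, involutive_restrict, hf, hg, Subtype.ext_iff]

theorem ncard_fixedPoints_restrict {T : Set W} (h : MapsTo f T T) :
    (Function.fixedPoints (h.restrict f T T)).ncard = (Function.fixedPoints f ∩ T).ncard := by
  rw [← ncard_image_of_injective _ Subtype.val_injective, inter_comm, ← Subtype.image_preimage_coe]
  congr 2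
  ext x
  simp [Function.mem_fixedPoints, Function.IsFixedPt, Subtype.ext_iff]

theorem exists_strand_inter_fixedPoints_eq_pair [Finite W] (hf : Function.Involutive f)
    (hg : Function.Involutive g) (hfg : Disjoint (Function.fixedPoints f) (Function.fixedPoints g))
    (hx : x ∈ Function.fixedPoints f ∪ Function.fixedPoints g) :
    ∃ y ≠ x, strand f g x ∩ (Function.fixedPoints f ∪ Function.fixedPoints g) = {x, y} := by
  have hfT : MapsTo f (strand f g x) (strand f g x) := fun _ => apply_mem_strand_left hf hg
  have hgT : MapsTo g (strand f g x) (strand f g x) := fun _ => apply_mem_strand_right hf hg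
  have hcard := ncard_fixedPoints_add_eq_zero_or_two (involutive_restrict hf hfT)
    (involutive_restrict hg hgT)
    (superposition_restrict hf hg hfT hgT ▸ connected_induce_strand f g x)
  have hmem : x ∈ strand f g x ∩ (Function.fixedPoints f ∪ Function.fixedPoints g) :=
    ⟨mem_strand_self, hx⟩
  rw [ncard_fixedPoints_restrict, ncard_fixedPoints_restrict,
    ← ncard_union_eq (hfg.mono inter_subset_left inter_subset_left), ← union_inter_distrib_right,
    inter_comm, ncard_eq_zero] at hcard
  have htwo := hcard.resolve_left (nonempty_of_mem hmem).ne_empty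
  obtain ⟨u, v, huv, heq⟩ := ncard_eq_two.mp htwo
  rcases heq ▸ hmem with rfl | rfl
  · exact ⟨v, huv.symm, heq⟩
  · exact ⟨u, huv, heq.trans (pair_comm _ _)⟩

end Involution

section NonCrossing

theorem odd_add_apply_of_noncrossing {m : ℕ} {σ : Fin m → Fin m} (hσ : Function.Involutive σ)
    (hne : ∀ i, σ i ≠ i) (hcross : ∀ i j, i < j → j < σ i → ¬ σ i < σ j) (i : Fin m) :
    Odd ((i : ℕ) + σ i) := by
  wlog hi : i < σ i generalizing i
  · have := this (σ i) (by rw [hσ i]; exact lt_of_le_of_ne (not_lt.mp hi) (hne i))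
    rwa [hσ i, add_comm] at this
  have hmaps : MapsTo σ (Ioo i (σ i)) (Ioo i (σ i)) := fun j hj => by
    have h₁ := hcross i j hj.1 hj.2
    have h₂ : ¬ σ j < i := fun h => hcross (σ j) i h (by rw [hσ j]; exact hj.1)
      (by rw [hσ j]; exact hj.2)
    have h₃ : σ j ≠ i := fun h => hj.2.ne (hσ.eq_iff.mp h)
    have h₄ : σ j ≠ σ i := fun h => hj.1.ne' (hσ.injective h)
    exact ⟨lt_of_le_of_ne (not_lt.mp h₂) h₃.symm, lt_of_le_of_ne (not_lt.mp h₁) h₄⟩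
  have hfix : Function.fixedPoints (hmaps.restrict σ _ _) = ∅ :=
    eq_empty_of_forall_notMem fun j hj => hne j (congrArg Subtype.val hj)
  have hcard := two_mul_ncard_edgeSet_involutionGraph (involutive_restrict hσ hmaps)
  rw [hfix, ncard_empty, Nat.card_eq_fintype_card, Fintype.card_ofFinset, Fin.card_Ioo] at hcard
  rw [Nat.odd_iff]
  have : (i : ℕ) < σ i := hi
  lia

variable {W : Type*} {G : SimpleGraph W} {D : PlaneDrawing G} {F : Set ℂ} {m : ℕ} {c : Fin m → W}
  {f g : W → W}

theorem exists_odd_add_and_strand_inter_range_eq_pair [Finite W] (hF : Disjoint F D.carrier)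
    (hc : D.InCyclicOrderOn F c) (hf : Function.Involutive f) (hg : Function.Involutive g)
    (hG : superposition f g ≤ G) (hfg : Disjoint (Function.fixedPoints f) (Function.fixedPoints g))
    (hrange : Function.fixedPoints f ∪ Function.fixedPoints g = range c) (i : Fin m) :
    ∃ i' : Fin m, Odd ((i : ℕ) + i') ∧ strand f g (c i) ∩ range c = {c i, c i'} := by
  have hpair : ∀ i, ∃ i', i' ≠ i ∧ strand f g (c i) ∩ range c = {c i, c i'} := fun i => by
    obtain ⟨y, hy, heq⟩ := exists_strand_inter_fixedPoints_eq_pair hf hg hfg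
      (hrange ▸ mem_range_self i)
    rw [hrange] at heq
    obtain ⟨i', rfl⟩ : y ∈ range c := (heq.ge (mem_insert_of_mem _ rfl)).2
    exact ⟨i', fun h => hy (congrArg c h), heq⟩
  choose σ hne hσ using hpair
  have hend : ∀ i j, c j ∈ strand f g (c i) ↔ j = i ∨ j = σ i := fun i j => by
    have : c j ∈ strand f g (c i) ∩ range c ↔ j = i ∨ j = σ i := by
      rw [hσ i, mem_insert_iff, mem_singleton_iff, hc.injective.eq_iff, hc.injective.eq_iff]
    rwa [mem_inter_iff, and_iff_left (mem_range_self j)] at this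
  have hinv : Function.Involutive σ := fun i => by
    have := (hend (σ i) i).mp (mem_strand_comm.mp ((hend i (σ i)).mpr (Or.inr rfl)))
    exact (this.resolve_left (hne i).symm).symm
  have hconn : ∀ x, (G.induce (strand f g x)).Preconnected := fun x =>
    (connected_induce_strand f g x).preconnected.mono fun _ _ h => hG h
  refine ⟨σ i, odd_add_apply_of_noncrossing hinv hne (fun p q hpq hqp hσpq => ?_) i, hσ i⟩
  refine hc.not_disjoint hF hpq hqp hσpq (hconn (c p)) (hconn (c q)) mem_strand_self
    ((hend p _).mpr (Or.inr rfl)) mem_strand_self ((hend q _).mpr (Or.inr rfl))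
    (disjoint_strand_of_notMem ?_)
  rw [hend]
  exact not_or_intro hpq.ne' hqp.ne

end NonCrossing

section Swap

variable {W : Type*} {f g : W → W}

theorem involutive_piecewise {T : Set W} [DecidablePred (· ∈ T)] (hf : Function.Involutive f)
    (hg : Function.Involutive g) (hfT : MapsTo f T T) (hgT : MapsTo g T T) :
    Function.Involutive (T.piecewise f g) := fun x => by
  by_cases hx : x ∈ T
  · simp [hx, hfT hx, hf x]
  · have hgx : g x ∉ T := fun h => hx (hg x ▸ hgT h)
    simp [hx, hgx, hg x]

theorem fixedPoints_piecewise (T : Set W) [DecidablePred (· ∈ T)] (f g : W → W) :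
    Function.fixedPoints (T.piecewise f g) =
      Function.fixedPoints f ∩ T ∪ Function.fixedPoints g \ T := by
  ext x
  by_cases hx : x ∈ T <;> simp [hx, Function.mem_fixedPoints, Function.IsFixedPt]

open Classical in
/-- The pair of involutions obtained by exchanging the two given ones on the strand of `x`. -/
noncomputable def swapStrand (x : W) (p : (W → W) × (W → W)) : (W → W) × (W → W) :=
  ((strand p.1 p.2 x).piecewise p.2 p.1, (strand p.1 p.2 x).piecewise p.1 p.2)

variable (x : W)

open Classical in
theorem involutive_swapStrand_fst (hf : Function.Involutive f) (hg : Function.Involutive g) :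
    Function.Involutive (swapStrand x (f, g)).1 :=
  involutive_piecewise hg hf (fun _ => apply_mem_strand_right hf hg)
    fun _ => apply_mem_strand_left hf hg

open Classical in
theorem involutive_swapStrand_snd (hf : Function.Involutive f) (hg : Function.Involutive g) :
    Function.Involutive (swapStrand x (f, g)).2 :=
  involutive_piecewise hf hg (fun _ => apply_mem_strand_left hf hg)
    fun _ => apply_mem_strand_right hf hg

theorem superposition_swapStrand (hf : Function.Involutive f) (hg : Function.Involutive g) :
    superposition (swapStrand x (f, g)).1 (swapStrand x (f, g)).2 = superposition f g := by
  ext u v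
  rw [superposition_adj (involutive_swapStrand_fst x hf hg) (involutive_swapStrand_snd x hf hg),
    superposition_adj hf hg]
  by_cases hu : u ∈ strand f g x <;> simp [swapStrand, hu, or_comm]

theorem strand_swapStrand (hf : Function.Involutive f) (hg : Function.Involutive g) (y : W) :
    strand (swapStrand x (f, g)).1 (swapStrand x (f, g)).2 y = strand f g y := by
  rw [strand, superposition_swapStrand x hf hg, strand]

theorem swapStrand_swapStrand (hf : Function.Involutive f) (hg : Function.Involutive g) :
    swapStrand x (swapStrand x (f, g)) = (f, g) := by
  have hstrand := strand_swapStrand x hf hg x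
  rw [swapStrand, hstrand]
  ext u <;> by_cases hu : u ∈ strand f g x <;> simp [swapStrand, hu]

/-- The weight of the matching given by an involution. -/
noncomputable def involutionWeight {R : Type*} [CommSemiring R] (w : Sym2 W → R) (f : W → W) : R :=
  ∏ᶠ z ∈ (involutionGraph f).edgeSet, w z

theorem involutionWeight_swapStrand [Finite W] {R : Type*} [CommSemiring R] (w : Sym2 W → R)
    (hf : Function.Involutive f) (hg : Function.Involutive g) :
    involutionWeight w (swapStrand x (f, g)).1 * involutionWeight w (swapStrand x (f, g)).2 =
      involutionWeight w f * involutionWeight w g := by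
  classical
  simp only [involutionWeight, finprod_mem_def]
  rw [← finprod_mul_distrib (toFinite _) (toFinite _),
    ← finprod_mul_distrib (toFinite _) (toFinite _)]
  refine finprod_congr (Sym2.ind fun u v => ?_)
  simp only [mulIndicator_apply, SimpleGraph.mem_edgeSet, involutionGraph_adj hf,
    involutionGraph_adj hg, involutionGraph_adj (involutive_swapStrand_fst x hf hg),
    involutionGraph_adj (involutive_swapStrand_snd x hf hg)]
  by_cases hu : u ∈ strand f g x <;> simp [swapStrand, hu, mul_comm]

end Swap

section Matchings

variable {W : Type*} {G : SimpleGraph W} {S : Set W} {f : W → W} {x : W}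

/-- A perfect matching of `G - S`, encoded as the involution of all vertices of `G` that exchanges
the ends of each edge of the matching and fixes `S`. -/
structure IsMatchingInvolution (G : SimpleGraph W) (S : Set W) (f : W → W) : Prop where
  involutive : Function.Involutive f
  fixedPoints_eq : Function.fixedPoints f = S
  le : involutionGraph f ≤ G

theorem IsMatchingInvolution.apply_eq_iff (hf : IsMatchingInvolution G S f) : f x = x ↔ x ∈ S := by
  rw [← hf.fixedPoints_eq, Function.mem_fixedPoints_iff]

theorem IsMatchingInvolution.adj_apply (hf : IsMatchingInvolution G S f) (hx : x ∉ S) :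
    G.Adj x (f x) :=
  hf.le ((involutionGraph_adj hf.involutive).mpr ⟨fun h => hx (hf.apply_eq_iff.mp h.symm), rfl⟩)

theorem IsMatchingInvolution.apply_notMem (hf : IsMatchingInvolution G S f) (hx : x ∉ S) :
    f x ∉ S := fun h =>
  hx (hf.apply_eq_iff.mp (hf.involutive.injective (hf.apply_eq_iff.mpr h)))

variable {V : Type*} {H : SimpleGraph V} {e : H ↪g G}

/-- The perfect matching of `H`, as a subgraph, given by an involution of the vertices of a larger
graph that fixes the vertices outside `H`. -/
def IsMatchingInvolution.toSubgraph (hf : IsMatchingInvolution G (range e)ᶜ f) : H.Subgraph where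
  verts := univ
  Adj u v := f (e u) = e v
  adj_sub {u _} h := e.map_adj_iff.mp (h ▸ hf.adj_apply (notMem_compl_iff.mpr (mem_range_self u)))
  edge_vert _ := mem_univ _
  symm := ⟨fun _ _ h => (hf.involutive.eq_iff.mp h).symm⟩

theorem IsMatchingInvolution.isPerfectMatching_toSubgraph
    (hf : IsMatchingInvolution G (range e)ᶜ f) : hf.toSubgraph.IsPerfectMatching := by
  refine ⟨fun u _ => ?_, fun _ => mem_univ _⟩
  obtain ⟨v, hv⟩ := notMem_compl_iff.mp (hf.apply_notMem (notMem_compl_iff.mpr (mem_range_self u)))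
  exact ⟨v, hv.symm, fun v' (hv' : f (e u) = e v') => e.injective (hv'.symm.trans hv.symm)⟩

theorem IsMatchingInvolution.edgeSet_involutionGraph
    (hf : IsMatchingInvolution G (range e)ᶜ f) :
    (involutionGraph f).edgeSet = Sym2.map e '' hf.toSubgraph.edgeSet := by
  ext z
  induction z using Sym2.ind with | _ x y
  rw [SimpleGraph.mem_edgeSet, involutionGraph_adj hf.involutive]
  constructor
  · rintro ⟨hxy, rfl⟩
    have hx : x ∉ (range e)ᶜ := fun h => hxy (hf.apply_eq_iff.mpr h).symm
    obtain ⟨v, hv⟩ := notMem_compl_iff.mp (hf.apply_notMem hx)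
    obtain ⟨u, rfl⟩ := notMem_compl_iff.mp hx
    exact ⟨s(u, v), hv.symm, congrArg (s(e u, ·)) hv⟩
  · rintro ⟨z, hz, h⟩
    induction z using Sym2.ind with | _ u v
    have huv : f (e u) = e v := hz
    have hvu : f (e v) = e u := hf.toSubgraph.adj_symm hz
    have hne : e u ≠ e v := e.injective.ne (hf.toSubgraph.adj_sub hz).ne
    rcases Sym2.eq_iff.mp h with ⟨rfl, rfl⟩ | ⟨rfl, rfl⟩
    exacts [⟨hne, huv⟩, ⟨hne.symm, hvu⟩]

theorem exists_isMatchingInvolution_toSubgraph_eq (e : H ↪g G) {P : H.Subgraph}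
    (hP : P.IsPerfectMatching) :
    ∃ (f : W → W) (hf : IsMatchingInvolution G (range e)ᶜ f), hf.toSubgraph = P := by
  choose m hm hunique using fun u => hP.1 (hP.2 u)
  have hmm : Function.Involutive m := fun u => (hunique (m u) u (hm u).symm).symm
  have hfe : ∀ u, Function.extend e (e ∘ m) id (e u) = e (m u) :=
    fun u => e.injective.extend_apply _ _ u
  have hfo : ∀ x ∉ range e, Function.extend e (e ∘ m) id x = x :=
    fun x hx => Function.extend_apply' _ _ x hx
  have hinv : Function.Involutive (Function.extend e (e ∘ m) id) := fun x => by
    by_cases hx : x ∈ range e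
    · obtain ⟨u, rfl⟩ := hx
      rw [hfe, hfe, hmm]
    · rw [hfo x hx, hfo x hx]
  refine ⟨_, ⟨hinv, ?_, fun x y hxy => ?_⟩, ?_⟩
  · ext x
    refine ⟨?_, hfo x⟩
    rintro hx ⟨u, rfl⟩
    exact (hm u).ne (e.injective ((hfe u).symm.trans hx)).symm
  · obtain ⟨hne, rfl⟩ := (involutionGraph_adj hinv).mp hxy
    obtain ⟨u, rfl⟩ : x ∈ range e := by_contra fun hx => hne (hfo x hx).symm
    rw [hfe]
    exact e.map_adj_iff.mpr (hm u).adj_sub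
  · refine SimpleGraph.Subgraph.ext (eq_univ_of_forall hP.2).symm (funext₂ fun u v => propext ?_)
    change Function.extend e (e ∘ m) id (e u) = e v ↔ P.Adj u v
    rw [hfe, e.injective.eq_iff]
    exact ⟨fun h => h ▸ hm u, fun h => (hunique u v h).symm⟩

theorem IsMatchingInvolution.eq_of_toSubgraph_eq {g : W → W}
    (hf : IsMatchingInvolution G (range e)ᶜ f) (hg : IsMatchingInvolution G (range e)ᶜ g)
    (h : hf.toSubgraph = hg.toSubgraph) : f = g := by
  funext x
  by_cases hx : x ∈ (range e)ᶜ
  · rw [hf.apply_eq_iff.mpr hx, hg.apply_eq_iff.mpr hx]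
  · obtain ⟨v, hv⟩ := notMem_compl_iff.mp (hf.apply_notMem hx)
    obtain ⟨u, rfl⟩ := notMem_compl_iff.mp hx
    have hadj : hf.toSubgraph.Adj u v := hv.symm
    have hgu : g (e u) = e v := by rwa [h] at hadj
    exact hv.symm.trans hgu.symm

variable {R : Type*} [CommSemiring R] (w : Sym2 W → R)

theorem IsMatchingInvolution.involutionWeight_eq (hf : IsMatchingInvolution G (range e)ᶜ f) :
    involutionWeight w f = ∏ᶠ z : hf.toSubgraph.edgeSet, w (Sym2.map e z) := by
  rw [involutionWeight, hf.edgeSet_involutionGraph,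
    finprod_mem_image (Sym2.map.injective e.injective).injOn,
    finprod_set_coe_eq_finprod_mem (f := fun z => w (Sym2.map e z))]

variable [Finite W]

/-- The perfect matchings of `G - S`, encoded as involutions. -/
noncomputable def matchingInvolutions (G : SimpleGraph W) (S : Set W) : Finset (W → W) :=
  (toFinite {f | IsMatchingInvolution G S f}).toFinset

theorem mem_matchingInvolutions : f ∈ matchingInvolutions G S ↔ IsMatchingInvolution G S f :=
  Finite.mem_toFinset _

theorem matchingSum_eq_sum [Finite V] (e : H ↪g G) (hS : (range e)ᶜ = S) :
    matchingSum H (fun z => w (Sym2.map e z)) =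
      ∑ f ∈ matchingInvolutions G S, involutionWeight w f := by
  subst hS
  rw [matchingInvolutions, ← finsum_mem_eq_finite_toFinset_sum, ← finsum_set_coe_eq_finsum_mem]
  refine (finsum_eq_of_bijective
    (fun f => ⟨f.2.toSubgraph, f.2.isPerfectMatching_toSubgraph⟩)
    ⟨fun f g h => Subtype.ext (f.2.eq_of_toSubgraph_eq g.2 (congrArg Subtype.val h)), ?_⟩
    fun f => f.2.involutionWeight_eq w).symm
  rintro ⟨P, hP⟩
  obtain ⟨f, hf, h⟩ := exists_isMatchingInvolution_toSubgraph_eq e hP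
  exact ⟨⟨f, hf⟩, Subtype.ext h⟩

theorem matchingSumDelete_eq_sum (G : SimpleGraph W) (S : Set W) :
    matchingSumDelete G w S = ∑ f ∈ matchingInvolutions G S, involutionWeight w f :=
  matchingSum_eq_sum w (SimpleGraph.Embedding.induce Sᶜ)
    ((congrArg compl Subtype.range_coe).trans (compl_compl S))

theorem matchingSumDelete_empty (G : SimpleGraph W) :
    matchingSumDelete G w ∅ = matchingSum G w := by
  have h := matchingSum_eq_sum w (SimpleGraph.Embedding.refl (G := G))
    ((congrArg compl range_id).trans compl_univ)
  rw [matchingSumDelete_eq_sum, ← h]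
  exact congrArg (matchingSum G) (funext fun z => congrArg w (congrFun Sym2.map_id z))

theorem matchingSumDelete_eq_zero {U V : Set W} (hG : G.IsBipartiteWith U V)
    (hcard : (U \ S).ncard < (V \ S).ncard) : matchingSumDelete G w S = 0 := by
  rw [matchingSumDelete_eq_sum]
  refine Finset.sum_eq_zero fun f hf => absurd hcard (not_lt.mpr ?_)
  rw [mem_matchingInvolutions] at hf
  refine ncard_le_ncard_of_injOn f (fun x hx => ⟨?_, hf.apply_notMem hx.2⟩)
    hf.involutive.injective.injOn
  exact hG.symm.mem_of_mem_adj hx.1 (hf.adj_apply hx.2)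

end Matchings

section Linked

variable {W : Type*} {G : SimpleGraph W} {C S S' : Set W} {f g : W → W} {x y : W}

theorem IsMatchingInvolution.swapStrand_fst (hf : IsMatchingInvolution G S f)
    (hg : IsMatchingInvolution G S' g) (x : W) :
    IsMatchingInvolution G (S' ∩ strand f g x ∪ S \ strand f g x) (swapStrand x (f, g)).1 where
  involutive := involutive_swapStrand_fst x hf.involutive hg.involutive
  fixedPoints_eq := by
    rw [swapStrand, fixedPoints_piecewise, hf.fixedPoints_eq, hg.fixedPoints_eq]
  le := le_sup_left.trans ((superposition_swapStrand x hf.involutive hg.involutive).trans_le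
    (sup_le hf.le hg.le))

theorem IsMatchingInvolution.swapStrand_snd (hf : IsMatchingInvolution G S f)
    (hg : IsMatchingInvolution G S' g) (x : W) :
    IsMatchingInvolution G (S ∩ strand f g x ∪ S' \ strand f g x) (swapStrand x (f, g)).2 where
  involutive := involutive_swapStrand_snd x hf.involutive hg.involutive
  fixedPoints_eq := by
    rw [swapStrand, fixedPoints_piecewise, hf.fixedPoints_eq, hg.fixedPoints_eq]
  le := le_sup_right.trans ((superposition_swapStrand x hf.involutive hg.involutive).trans_le
    (sup_le hf.le hg.le))

variable [Finite W]

open Classical in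
/-- The pairs of a perfect matching of `G - S` and a perfect matching of `G - (C \ S)` in whose
superposition the strand of `x` meets `C` in `x` and `y` only. -/
noncomputable def linkedPairs (G : SimpleGraph W) (C S : Set W) (x y : W) :
    Finset ((W → W) × (W → W)) :=
  {p ∈ matchingInvolutions G S ×ˢ matchingInvolutions G (C \ S) |
    strand p.1 p.2 x ∩ C = {x, y}}

theorem mem_linkedPairs : (f, g) ∈ linkedPairs G C S x y ↔
    (IsMatchingInvolution G S f ∧ IsMatchingInvolution G (C \ S) g) ∧
      strand f g x ∩ C = {x, y} := by
  rw [linkedPairs, Finset.mem_filter, Finset.mem_product, mem_matchingInvolutions,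
    mem_matchingInvolutions]

theorem linkedPairs_comm (G : SimpleGraph W) (C S : Set W) (x y : W) :
    linkedPairs G C S x y = linkedPairs G C S y x := by
  have hswap : ∀ {f g x y}, strand f g x ∩ C = {x, y} → strand f g y ∩ C = {y, x} :=
    fun {f g x y} h => by
      have hy : y ∈ strand f g x ∩ C := h ▸ mem_insert_of_mem _ rfl
      rw [strand_eq_of_mem hy.1, h, pair_comm]
  ext ⟨f, g⟩
  rw [mem_linkedPairs, mem_linkedPairs]
  exact and_congr_right fun _ => ⟨hswap, hswap⟩

theorem swapStrand_mem_linkedPairs (hS : S ⊆ C) {p : (W → W) × (W → W)}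
    (hp : p ∈ linkedPairs G C S x y) : swapStrand x p ∈ linkedPairs G C (S ∆ {x, y}) x y := by
  obtain ⟨f, g⟩ := p
  obtain ⟨⟨hf, hg⟩, hxy⟩ := mem_linkedPairs.mp hp
  have hfst : S ∆ {x, y} = C \ S ∩ strand f g x ∪ S \ strand f g x := by
    rw [← hxy]
    grind
  have hsnd : C \ S ∆ {x, y} = S ∩ strand f g x ∪ (C \ S) \ strand f g x := by
    rw [← hxy]
    grind
  exact mem_linkedPairs.mpr ⟨⟨hfst ▸ hf.swapStrand_fst hg x, hsnd ▸ hf.swapStrand_snd hg x⟩,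
    (strand_swapStrand x hf.involutive hg.involutive x).symm ▸ hxy⟩

/-- The sum of the products of weights of the pairs of matchings in `linkedPairs G C S x y`. -/
noncomputable def linkedSum {R : Type*} [CommSemiring R] (G : SimpleGraph W) (w : Sym2 W → R)
    (C S : Set W) (x y : W) : R :=
  ∑ p ∈ linkedPairs G C S x y, involutionWeight w p.1 * involutionWeight w p.2

variable {R : Type*} [CommSemiring R] (w : Sym2 W → R)

theorem linkedSum_comm (G : SimpleGraph W) (C S : Set W) (x y : W) :
    linkedSum G w C S x y = linkedSum G w C S y x := by
  rw [linkedSum, linkedPairs_comm, linkedSum]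

theorem linkedSum_symmDiff_pair (hS : S ⊆ C) (hx : x ∈ C) (hy : y ∈ C) :
    linkedSum G w C (S ∆ {x, y}) x y = linkedSum G w C S x y := by
  have hS' : S ∆ {x, y} ⊆ C :=
    symmDiff_subset_union.trans (union_subset hS (pair_subset hx hy))
  have hinv : ∀ {S}, ∀ p ∈ linkedPairs G C S x y, swapStrand x (swapStrand x p) = p :=
    fun p hp => by
      obtain ⟨⟨hf, hg⟩, -⟩ := mem_linkedPairs.mp hp
      exact swapStrand_swapStrand x hf.involutive hg.involutive
  refine Finset.sum_nbij' (swapStrand x) (swapStrand x) (fun p hp => ?_)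
    (fun p hp => swapStrand_mem_linkedPairs hS hp) hinv hinv (fun p hp => ?_)
  · have := swapStrand_mem_linkedPairs hS' hp
    rwa [symmDiff_symmDiff_cancel_right] at this
  · obtain ⟨⟨hf, hg⟩, -⟩ := mem_linkedPairs.mp hp
    exact (involutionWeight_swapStrand x w hf.involutive hg.involutive).symm

variable {D : PlaneDrawing G} {F : Set ℂ} {m : ℕ} {c : Fin m → W}

theorem matchingSumDelete_mul_eq_sum_linkedSum (hF : Disjoint F D.carrier)
    (hc : D.InCyclicOrderOn F c) (hS : S ⊆ range c) (i : Fin m) :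
    matchingSumDelete G w S * matchingSumDelete G w (range c \ S) =
      ∑ i' ∈ {i' : Fin m | Odd ((i : ℕ) + i')}, linkedSum G w (range c) S (c i) (c i') := by
  classical
  rw [matchingSumDelete_eq_sum, matchingSumDelete_eq_sum, Finset.sum_mul_sum,
    ← Finset.sum_product']
  simp only [linkedSum, linkedPairs, Finset.sum_filter (s := _ ×ˢ _)]
  rw [Finset.sum_comm]
  refine Finset.sum_congr rfl fun ⟨f, g⟩ hp => ?_
  obtain ⟨hf, hg⟩ : IsMatchingInvolution G S f ∧ IsMatchingInvolution G (range c \ S) g := by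
    simpa only [Finset.mem_product, mem_matchingInvolutions] using hp
  obtain ⟨i', hodd, hi'⟩ := exists_odd_add_and_strand_inter_range_eq_pair hF hc hf.involutive
    hg.involutive (sup_le hf.le hg.le)
    (by rw [hf.fixedPoints_eq, hg.fixedPoints_eq]; exact disjoint_sdiff_right)
    (by rw [hf.fixedPoints_eq, hg.fixedPoints_eq]; exact union_sdiff_cancel hS) i
  rw [Finset.sum_eq_single_of_mem i' (by simpa using hodd), if_pos hi']
  refine fun l hl hne => if_neg fun hl' => hne (hc.injective ?_)
  have hmem : c l ∈ ({c i, c i'} : Set W) := hi' ▸ hl' ▸ mem_insert_of_mem _ rfl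
  refine hmem.resolve_left fun h => ?_
  obtain rfl := hc.injective h
  exact Nat.not_odd_iff_even.mpr (.add_self _) (Finset.mem_filter.mp hl).2

theorem sum_even_matchingSumDelete_mul_eq_sum_odd (hF : Disjoint F D.carrier)
    (hc : D.InCyclicOrderOn F c) (hS : S ⊆ range c) :
    ∑ i ∈ {i : Fin m | Even (i : ℕ)}, matchingSumDelete G w (S ∆ {c i}) *
        matchingSumDelete G w (range c \ S ∆ {c i}) =
      ∑ i ∈ {i : Fin m | Odd (i : ℕ)}, matchingSumDelete G w (S ∆ {c i}) *
        matchingSumDelete G w (range c \ S ∆ {c i}) := by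
  have hsub : ∀ i, S ∆ {c i} ⊆ range c := fun i =>
    symmDiff_subset_union.trans (union_subset hS (singleton_subset_iff.mpr (mem_range_self i)))
  have hlinked : ∀ {i i' : Fin m}, Odd ((i : ℕ) + i') →
      linkedSum G w (range c) (S ∆ {c i}) (c i) (c i') =
        linkedSum G w (range c) (S ∆ {c i'}) (c i') (c i) := fun {i i'} h => by
    have hne : c i ≠ c i' := fun hii => by
      obtain rfl := hc.injective hii
      exact Nat.not_odd_iff_even.mpr (.add_self _) h
    have hpair : S ∆ {c i'} = S ∆ {c i} ∆ {c i, c i'} := by grind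
    rw [linkedSum_comm _ _ _ _ (c i') (c i), hpair,
      linkedSum_symmDiff_pair w (hsub i) (mem_range_self i) (mem_range_self i')]
  have hexpand := fun i => matchingSumDelete_mul_eq_sum_linkedSum w hF hc (hsub i) i
  rw [Finset.sum_congr rfl fun i _ => hexpand i, Finset.sum_congr rfl fun i _ => hexpand i,
    Finset.sum_comm' (t' := {i' : Fin m | Odd (i' : ℕ)})
    (s' := fun i' => {i : Fin m | Odd ((i' : ℕ) + i)})]
  · exact Finset.sum_congr rfl fun i' _ => Finset.sum_congr rfl fun i hi =>
      hlinked (by simpa [add_comm] using hi)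
  · intro i i'
    simp only [Finset.mem_filter, Finset.mem_univ, true_and]
    grind

end Linked

section Interleave

variable {W : Type*} {k : ℕ}

theorem interleave_two_mul (a b : Fin k → W) (i : Fin k) :
    interleave a b ⟨2 * i, by omega⟩ = a i := by
  simp [interleave]

theorem interleave_two_mul_add_one (a b : Fin k → W) (i : Fin k) :
    interleave a b ⟨2 * i + 1, by omega⟩ = b i := by
  have h : (2 * (i : ℕ) + 1) / 2 = i := by omega
  simp [interleave, h]

theorem range_interleave (a b : Fin k → W) : range (interleave a b) = range a ∪ range b := by
  refine Subset.antisymm ?_ (union_subset ?_ ?_)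
  · rintro _ ⟨i, rfl⟩
    unfold interleave
    split_ifs
    exacts [Or.inl (mem_range_self _), Or.inr (mem_range_self _)]
  · rintro _ ⟨i, rfl⟩
    exact ⟨_, interleave_two_mul a b i⟩
  · rintro _ ⟨i, rfl⟩
    exact ⟨_, interleave_two_mul_add_one a b i⟩

variable {R : Type*} [AddCommMonoid R]

theorem sum_even_interleave (a b : Fin k → W) (φ : W → R) :
    ∑ i ∈ {i : Fin (2 * k) | Even (i : ℕ)}, φ (interleave a b i) = ∑ i, φ (a i) := by
  refine (Finset.sum_nbij (fun i : Fin k => (⟨2 * i, by omega⟩ : Fin (2 * k))) (fun i _ => by simp)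
    (fun i _ i' _ h => ?_) (fun i hi => ?_) fun i _ => by rw [interleave_two_mul]).symm
  · simpa [Fin.ext_iff] using h
  · obtain ⟨r, hr⟩ := (Finset.mem_filter.mp hi).2
    exact ⟨⟨r, by omega⟩, Finset.mem_coe.mpr (Finset.mem_univ _), Fin.ext (by simp only; omega)⟩

theorem sum_odd_interleave (a b : Fin k → W) (φ : W → R) :
    ∑ i ∈ {i : Fin (2 * k) | Odd (i : ℕ)}, φ (interleave a b i) = ∑ i, φ (b i) := by
  refine (Finset.sum_nbij (fun i : Fin k => (⟨2 * i + 1, by omega⟩ : Fin (2 * k)))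
    (fun i _ => by simp) (fun i _ i' _ h => ?_) (fun i hi => ?_)
    fun i _ => by rw [interleave_two_mul_add_one]).symm
  · simpa [Fin.ext_iff] using h
  · obtain ⟨r, hr⟩ := (Finset.mem_filter.mp hi).2
    exact ⟨⟨r, by omega⟩, Finset.mem_coe.mpr (Finset.mem_univ _), Fin.ext (by simp only; omega)⟩

end Interleave

theorem corollary2p3_general {R : Type*} [CommSemiring R] {W : Type*} [Finite W]
    (G : SimpleGraph W) (w : Sym2 W → R) (D : PlaneDrawing G) (F : Set ℂ) (hF : D.IsFace F)
    (k : ℕ) (a b : Fin k → W) (hab : D.InCyclicOrderOn F (interleave a b)) (j : Fin k) :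
    matchingSum G w * matchingSumDelete G w (range a ∪ range b) +
        ∑ i ∈ Finset.univ.erase j, matchingSumDelete G w {a j, a i} *
          matchingSumDelete G w ((range a ∪ range b) \ {a j, a i}) =
      ∑ i : Fin k, matchingSumDelete G w {a j, b i} *
        matchingSumDelete G w ((range a ∪ range b) \ {a j, b i}) := by
  have ha : ∀ i ≠ j, a j ≠ a i := fun i hi h => by
    rw [← interleave_two_mul a b i, ← interleave_two_mul a b j, hab.injective.eq_iff] at h
    grind
  have hb : ∀ i, a j ≠ b i := fun i h => by
    rw [← interleave_two_mul a b j, ← interleave_two_mul_add_one a b i, hab.injective.eq_iff] at h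
    grind
  have hpair : ∀ {x y : W}, x ≠ y → ({x} : Set W) ∆ {y} = {x, y} := by grind
  have hmain := sum_even_matchingSumDelete_mul_eq_sum_odd (S := {a j}) w hF.disjoint_carrier hab
    (by rw [range_interleave]; exact singleton_subset_iff.mpr (Or.inl (mem_range_self j)))
  let φ x := matchingSumDelete G w ({a j} ∆ {x}) *
    matchingSumDelete G w (range (interleave a b) \ {a j} ∆ {x})
  rw [sum_even_interleave a b φ, sum_odd_interleave a b φ] at hmain
  have hφ : ∀ {x}, a j ≠ x → φ x = matchingSumDelete G w {a j, x} *
      matchingSumDelete G w ((range a ∪ range b) \ {a j, x}) := fun h => by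
    simp only [φ, hpair h, range_interleave]
  have hφj : φ (a j) = matchingSum G w * matchingSumDelete G w (range a ∪ range b) := by
    simp only [φ, symmDiff_self, bot_eq_empty, sdiff_empty, range_interleave,
      matchingSumDelete_empty]
  rw [← Finset.add_sum_erase _ _ (Finset.mem_univ j), hφj,
    Finset.sum_congr rfl fun i hi => hφ (ha i (Finset.ne_of_mem_erase hi)),
    Finset.sum_congr rfl fun i _ => hφ (hb i)] at hmain
  exact hmain

theorem corollary2p3 {R : Type*} [CommSemiring R] {W : Type*} [Finite W]
    (G : SimpleGraph W) (w : Sym2 W → R) (D : PlaneDrawing G)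
    (n : ℕ) (U V : Set W) (hbip : G.IsBipartiteWith U V) (hUV : U ∪ V = Set.univ)
    (hU : U.ncard = n) (hV : V.ncard = n)
    (F : Set ℂ) (hF : D.IsFace F)
    (k : ℕ) (a b : Fin k → W) (hab : D.InCyclicOrderOn F (interleave a b))
    (ha : Set.range a ⊆ U) (hb : Set.range b ⊆ V) (j : Fin k) :
    matchingSum G w * matchingSumDelete G w (Set.range a ∪ Set.range b) =
      ∑ i : Fin k, matchingSumDelete G w {a j, b i} *
        matchingSumDelete G w ((Set.range a ∪ Set.range b) \ {a j, b i}) := by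
  rw [← corollary2p3_general G w D F hF k a b hab j, Finset.sum_eq_zero, add_zero]
  intro i _
  have hS : {a j, a i} ⊆ U := pair_subset (ha (mem_range_self j)) (ha (mem_range_self i))
  rw [matchingSumDelete_eq_zero w hbip, zero_mul]
  rw [(hbip.disjoint.symm.mono_right hS).sdiff_eq_left, hV, ← hU]
  exact ncard_lt_ncard (hS.sdiff_ssubset_of_nonempty (insert_nonempty _ _))
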